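/- **Setting.** Let $K\ge 2$ items have scores $\theta_1=0$ and $\theta=(\theta_2,\dots,\theta_K)\in\mathbb R^{K-1}$ (Euclidean norm, Lebesgue measure $m$). Let $\mathcal A=\{(i,j):1\le i<j\le K\}$, let $P_K$ be the set of permutations of $\{1,\dots,K\}$, and let $r:\mathbb R^{K-1}\to P_K$ be a map such that $r(\theta)=(r_1,\dots,r_K)$ satisfies $\theta_{r_1}\ge\dots\ge\theta_{r_K}$ (ties broken in any fixed way). Comparing the pair $a\in\mathcal A$ gives an outcome $x\in\{0,1\}$ with probability mass function $f^a_\theta$. Write $D^{a}(\theta\|\tilde\theta)=\sum_{x}f^a_\theta(x)\log\frac{f^a_\theta(x)}{f^a_{\tilde\theta}(x)}$. The unknown parameter $\Theta$ has a prior density $\rho$ on $\mathbb R^{K-1}$. A sequential ranking policy $\pi=(A,T,R)$ selects, for each $n\ge1$, the pair $a_n$ at random from a probability distribution $\lambda_n$ on $\mathcal A$ that depends on the earlier observations $(a_k,X_k)_{k<n}$; given $\Theta=\theta$ and the past, $X_n\sim f^{a_n}_\theta$. $T\in\{0,1,2,\dots\}\cup\{\infty\}$ is a stopping time of the filtration generated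 by the observations ($\{T=n\}$ is determined by $(a_k,X_k)_{k\le n}$), and the ranking $R=(R_1,\dots,R_K)\in P_K$ ($R_i$ is the rank of item $i$) is determined by $(a_k,X_k)_{k\le T}$. For $c>0$ the Bayes risk and the minimal Bayes risk are $$V_c(\rho,\pi)=\mathbb E^\pi\Big[\sum_{i<j}\big(I(\Theta_i>\Theta_j)(1-R_{i,j})+I(\Theta_i<\Theta_j)R_{i,j}\big)\Big]+c\,\mathbb E^\pi T,\qquad R_{i,j}=I(R_i<R_j),\qquad V_c^*(\rho)=\inf_\pi V_c(\rho,\pi),$$ the infimum being over all sequential ranking policies. Let $W=\overline{\{\theta:\rho(\theta)>0\}}$ be the support of the prior, every neighbourhood of every point of $W$ having positive prior probability. With $\Delta$ the set of probability vectors $\lambda=(\lambda^a)_{a\in\mathcal A}$, let $$D(\theta)=\max_{\lambda\in\Delta}\ \min_{\tilde\theta\in W:\ r(\tilde\theta)\ne r(\theta)}\ \sum_{a\in\mathcal A}\lambda^{a}D^{a}(\theta\|\tilde\theta),\qquad t_c(\theta)=\frac{|\log c|}{D(\theta)} .$$ **Assumptions.** 1. $W$ is compact, and for every $\sigma\in P_K$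 the set $\{\theta:r(\theta)=\sigma\}\cap W$ has non-empty interior. 2. There is $\delta_b>0$ such that $m(B(\theta,s)\cap W)\ge\min\{\delta_b s^{K-1},1\}$ for all $\theta\in W$ and $s>0$, where $B(\theta,s)$ is the open ball. 3. $f^a_\theta(x)>0$ for all $\theta\in W$, and $\theta\mapsto\log f^a_\theta(x)$ is continuously differentiable near each point of $W$, for all $a,x$, with $\sup_{\theta\in W,\,a\in\mathcal A,\,x}\|\nabla_\theta\log f^a_\theta(x)\|<\infty$. 4. $\displaystyle\inf_{\theta,\tilde\theta\in W:\ r(\tilde\theta)\neq r(\theta)}\ \max_{a\in\mathcal A}D^{a}(\theta\|\tilde\theta)>0$. 5. $\inf_{\theta\in W^\circ}\rho(\theta)>0$ and $\sup_{\theta\in W}\rho(\theta)<\infty$. **Theorem 1.** Under Assumptions 1–5, $$\liminf_{c\to0^+}\frac{V_c^*(\rho)}{c\,\mathbb E\,t_c(\Theta)}\ \ge\ 1,\qquad \mathbb E\,t_c(\Theta)=\int_W t_c(\theta)\rho(\theta)\,d\theta .$$ -/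

import Mathlib

open MeasureTheory ProbabilityTheory Filter Topology
open scoped ENNReal

noncomputable section

namespace RankAgg

/-- The free scores `(θ_2, …, θ_K)` of `K = d + 1` items, in Euclidean space `ℝ^(K-1)`. -/
abbrev Param (d : ℕ) : Type := EuclideanSpace ℝ (Fin d)

/-- The scores of all `d + 1` items; the score of the first item is fixed to be `0`. -/
def score {d : ℕ} (θ : Param d) : Fin (d + 1) → ℝ :=
  Fin.cons 0 (fun i => θ i)

/-- The pairs `(i, j)` of items with `i < j`. -/
abbrev Pair (d : ℕ) : Type := {p : Fin (d + 1) × Fin (d + 1) // p.1 < p.2}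

/-- One observation: the compared pair and the outcome
(`true` means that the first item of the pair is preferred). -/
abbrev Obs (d : ℕ) : Type := Pair d × Bool

/-- A comparison model: the probability mass function `f_θ^a` of the outcome of comparing `a`. -/
abbrev Model (d : ℕ) : Type := Param d → Pair d → PMF Bool

/-- `r` sends every parameter to an ordering `(r_1, …, r_K)` of the items with
`θ_{r_1} ≥ … ≥ θ_{r_K}`; ties may be broken in any way. -/
def IsRankMap {d : ℕ} (r : Param d → Equiv.Perm (Fin (d + 1))) : Prop :=
  ∀ θ, Antitone fun k => score θ (r θ k)

/-- The number `f_θ^a(x)`. -/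
def prob {d : ℕ} (f : Model d) (θ : Param d) (a : Pair d) (x : Bool) : ℝ :=
  (f θ a x).toReal

/-- Kullback-Leibler divergence `D^a(θ ‖ θ') = ∑_x f_θ^a(x) log (f_θ^a(x) / f_θ'^a(x))`. -/
def kl {d : ℕ} (f : Model d) (a : Pair d) (θ θ' : Param d) : ℝ :=
  ∑ x : Bool, prob f θ a x * Real.log (prob f θ a x / prob f θ' a x)

/-- The max-min design value
`D(θ) = max_{λ ∈ Δ} min_{θ' ∈ W, r(θ') ≠ r(θ)} ∑_a λ^a D^a(θ ‖ θ')`. -/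
def designValue {d : ℕ} (f : Model d) (r : Param d → Equiv.Perm (Fin (d + 1)))
    (W : Set (Param d)) (θ : Param d) : ℝ :=
  ⨆ l : stdSimplex ℝ (Pair d), ⨅ θ' : {θ' : Param d // θ' ∈ W ∧ r θ' ≠ r θ},
    ∑ a : Pair d, (l : Pair d → ℝ) a * kl f a θ θ'

/-- `t_c(θ) = |log c| / D(θ)`, as an extended nonnegative number. -/
def tc {d : ℕ} (f : Model d) (r : Param d → Equiv.Perm (Fin (d + 1)))
    (W : Set (Param d)) (c : ℝ) (θ : Param d) : ℝ≥0∞ :=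
  ENNReal.ofReal |Real.log c| / ENNReal.ofReal (designValue f r W θ)

/-- The closure of the set on which the density `ρ` is positive. -/
def densitySupport {d : ℕ} (ρ : Param d → ℝ) : Set (Param d) :=
  closure {θ | 0 < ρ θ}

/-- The law on `ℝ^(K-1)` with Lebesgue density `ρ`. -/
def prior {d : ℕ} (ρ : Param d → ℝ) : Measure (Param d) :=
  volume.withDensity fun θ => ENNReal.ofReal (ρ θ)

/-- A sequential ranking policy.
* `sel n h` is the distribution from which pair number `n + 1` is drawn when `h` is the record of
  the first `n` pairs and outcomes;
* `halt n` is the set of records of length `n` at which sampling ends, if it has not ended before;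
* `dec n h` is the ranking announced on stopping with the record `h`; the value at `i` is the rank
  of item `i`, smaller meaning better. -/
structure Policy (d : ℕ) where
  sel : (n : ℕ) → (Fin n → Obs d) → PMF (Pair d)
  halt : (n : ℕ) → Set (Fin n → Obs d)
  dec : (n : ℕ) → (Fin n → Obs d) → Equiv.Perm (Fin (d + 1))

namespace Policy

variable {d : ℕ}

/-- The record of the first `n` observations. -/
def record (ω : ℕ → Obs d) (n : ℕ) : Fin n → Obs d := fun i => ω i

/-- Law of the next observation given the record `h`, under the parameter `θ`:
draw a pair from `sel n h`, then draw the outcome from the comparison model. -/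
def next (π : Policy d) (f : Model d) (θ : Param d) {n : ℕ} (h : Fin n → Obs d) : PMF (Obs d) :=
  (π.sel n h).bind fun a => (f θ a).map fun x => (a, x)

/-- `next` as a transition kernel from the observations with indices `0, …, n` to the one with
index `n + 1`. -/
def step (π : Policy d) (f : Model d) (θ : Param d) (n : ℕ) :
    Kernel ((i : Finset.Iic n) → (fun _ : ℕ => Obs d) i) ((fun _ : ℕ => Obs d) (n + 1)) where
  toFun x := (π.next f θ (n := n + 1)
    fun i => x ⟨i, Finset.mem_Iic.2 (Nat.lt_succ_iff.1 i.2)⟩).toMeasure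
  measurable' := Measurable.of_discrete

instance (π : Policy d) (f : Model d) (θ : Param d) (n : ℕ) : IsMarkovKernel (π.step f θ n) :=
  ⟨fun _ => PMF.toMeasure.isProbabilityMeasure _⟩

/-- The law `P_θ` of the whole sequence of observations when the pairs are selected by `π`. -/
def law (π : Policy d) (f : Model d) (θ : Param d) : Measure (ℕ → Obs d) :=
  Kernel.trajMeasure (X := fun _ : ℕ => Obs d) (π.next f θ (n := 0) Fin.elim0).toMeasure
    (π.step f θ)

/-- The stopping time `T`, which is also the number of comparisons made; it is `⊤` if sampling
never ends. -/
def time (π : Policy d) (ω : ℕ → Obs d) : ℕ∞ :=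
  ⨅ (n : ℕ) (_ : record ω n ∈ π.halt n), (n : ℕ∞)

/-- The ranking announced at the stopping time (it plays no role if sampling never ends, since
the cost is then infinite). -/
def decision (π : Policy d) (ω : ℕ → Obs d) : Equiv.Perm (Fin (d + 1)) :=
  π.dec (π.time ω).toNat (record ω (π.time ω).toNat)

end Policy

open Classical in
/-- Kendall's tau distance between the announced ranks `R` and the ranking induced by `θ`. -/
def kendall {d : ℕ} (θ : Param d) (R : Equiv.Perm (Fin (d + 1))) : ℕ :=
  ∑ a : Pair d,
    ((if score θ a.1.1 > score θ a.1.2 ∧ ¬ R a.1.1 < R a.1.2 then 1 else 0)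
      + (if score θ a.1.1 < score θ a.1.2 ∧ R a.1.1 < R a.1.2 then 1 else 0))

/-- The Bayes risk `V_c(ρ, π)`: the expectation of Kendall's tau distance plus `c T`. -/
def bayesRisk {d : ℕ} (f : Model d) (ρ : Param d → ℝ) (c : ℝ) (π : Policy d) : ℝ≥0∞ :=
  ∫⁻ θ, ∫⁻ ω, ((kendall θ (π.decision ω) : ℝ≥0∞)
    + ENNReal.ofReal c * ((π.time ω : ℕ∞) : ℝ≥0∞)) ∂(π.law f θ) ∂(prior ρ)

/-- The minimal Bayes risk `V*_c(ρ)` over all sequential ranking policies. -/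
def minRisk {d : ℕ} (f : Model d) (ρ : Param d → ℝ) (c : ℝ) : ℝ≥0∞ :=
  ⨅ π : Policy d, bayesRisk f ρ c π

end RankAgg

end

/-!
The lower bound is a change-of-measure argument carried out parameter by parameter. Write
`L = |log c|` and let `T`, `R` be the stopping time and the announced ranking of a policy. It may be
assumed that the Bayes risk of the policy is less than `c ∫ t_c`, hence of order `c L`.

Fix a parameter `θ` without ties and let `τ = (1 - δ) L / D(θ)`. If sampling ends at some
`n ≤ τ`, then the empirical frequencies of the compared pairs form a design, so some `θ'` with
another ranking carries total information at most about `n D(θ) ≤ (1 - δ) L` against `θ`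
(`exists_sum_kl_le`). The log-likelihood ratio of `θ` against `θ'` is this information plus a
stopped martingale with variance `O(L)`, which exceeds `δ L / 4` with probability `O(1 / L)` only
(`law_stopped_sum_gt_le`). Otherwise the likelihoods at `θ` and near `θ'` differ by a factor of at
most `exp ((1 - δ / 4) L)`. The correct decision for `θ` is wrong near `θ'`, so averaging over a
neighbourhood of `θ'` bounds the probability of this event by a constant times
`exp ((1 - δ / 4) L)` times the Bayes risk, which is of order `c ^ (δ / 4) L`
(`law_stopped_mul_prior_ball_le`). Since `W` is compact, finitely many neighbourhoods serve for all
`θ'` (`exists_finite_net`).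

Thus, uniformly in `θ` and in the policy, sampling ends by time `τ` without an inversion with
vanishing probability (`law_stopped_early_le`). In all other cases the cost is at least `c τ`,
either through the time or through an inversion, which costs `1 ≥ c τ`. Integrating over `θ` and letting
`δ → 0` gives the claim. As the estimate holds for each `θ` separately, no measurability in `θ` of
the law of the observations is needed.
-/

noncomputable section

namespace RankAgg

variable {d : ℕ}

namespace Policy

/-! ### The law of the observations -/

theorem next_apply (π : Policy d) (f : Model d) (θ : Param d) {n : ℕ} (h : Fin n → Obs d)
    (o : Obs d) : π.next f θ h o = π.sel n h o.1 * f θ o.1 o.2 := by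
  obtain ⟨a, x⟩ := o
  simp only [next, PMF.bind_apply, PMF.map_apply, Prod.mk.injEq]
  rw [tsum_eq_single a]
  · congr 1
    rw [tsum_eq_single x] <;> simp +contextual [eq_comm]
  · intro b hb
    simp [hb.symm]

instance (π : Policy d) (f : Model d) (θ : Param d) : IsProbabilityMeasure (π.law f θ) := by
  unfold law; infer_instance

theorem measurable_record (n : ℕ) : Measurable fun ω : ℕ → Obs d => record ω n := by
  unfold record; fun_prop

theorem measurableSet_record (n : ℕ) (H : Set (Fin n → Obs d)) :
    MeasurableSet {ω : ℕ → Obs d | record ω n ∈ H} :=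
  measurable_record n H.toFinite.measurableSet

theorem law_zero (π : Policy d) (f : Model d) (θ : Param d) (o : Obs d) :
    π.law f θ {ω | ω 0 = o} = π.next f θ (n := 0) Fin.elim0 o := by
  have key : (π.law f θ).map (Preorder.frestrictLe (π := fun _ => Obs d) 0)
      = (π.next f θ (n := 0) Fin.elim0).toMeasure.map (MeasurableEquiv.piUnique _).symm := by
    rw [law, Kernel.trajMeasure, Measure.map_comp _ _ (by fun_prop),
      Kernel.traj_map_frestrictLe_of_le le_rfl, Measure.deterministic_comp_eq_map]
    exact Measure.map_id
  have k2 := congrArg (fun μ => μ {x | x ⟨0, by simp⟩ = o}) key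
  rw [Measure.map_apply (by fun_prop) (Set.toFinite _).measurableSet,
    Measure.map_apply (by fun_prop) (Set.toFinite _).measurableSet] at k2
  exact k2.trans (PMF.toMeasure_apply_singleton (π.next f θ (n := 0) Fin.elim0) o
    (measurableSet_singleton o))

/-- Given the record of the first `n` observations, the next one has the law `next`. -/
theorem law_step (π : Policy d) (f : Model d) (θ : Param d) (n : ℕ) (h : Fin n → Obs d)
    (o : Obs d) :
    π.law f θ {ω | record ω n = h ∧ ω n = o}
      = π.law f θ {ω | record ω n = h} * π.next f θ h o := by
  cases n with
  | zero =>
    have e : ∀ ω : ℕ → Obs d, record ω 0 = h := fun ω => Subsingleton.elim _ _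
    simp only [e, true_and, Set.ofPred_true, measure_univ, one_mul, law_zero]
    rw [Subsingleton.elim h]
  | succ n =>
    have key := Kernel.map_frestrictLe_trajMeasure_compProd_eq_map_trajMeasure
      (X := fun _ : ℕ => Obs d)
      (μ₀ := (π.next f θ (n := 0) Fin.elim0).toMeasure) (κ := π.step f θ) (a := n)
    let g : (i : Finset.Iic n) → Obs d :=
      fun i => h ⟨i, Nat.lt_succ_iff.2 (Finset.mem_Iic.1 i.2)⟩
    have e : ∀ ω : ℕ → Obs d, record ω (n + 1) = h ↔
        Preorder.frestrictLe (π := fun _ => Obs d) n ω = g := by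
      intro ω
      constructor
      · rintro rfl
        rfl
      · intro hh
        funext i
        exact congrFun hh ⟨i, Finset.mem_Iic.2 (Nat.lt_succ_iff.1 i.2)⟩
    have k2 := congrArg (fun μ => μ ({g} ×ˢ {o})) key
    rw [Measure.compProd_apply_prod (measurableSet_singleton _) (measurableSet_singleton _),
      lintegral_singleton, Measure.map_apply (by fun_prop) (measurableSet_singleton _),
      Measure.map_apply (by fun_prop)
        ((measurableSet_singleton _).prod (measurableSet_singleton _))] at k2
    simp only [e]
    refine Eq.trans ?_ (k2.symm.trans ((mul_comm _ _).trans ?_))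
    · rw [law]
      congr 1
    · rw [law]
      congr 1
      exact PMF.toMeasure_apply_singleton (π.next f θ h) o (measurableSet_singleton o)

/-! ### Change of measure at the stopping time -/

theorem record_succ_eq_iff (n : ℕ) (h : Fin (n + 1) → Obs d) (ω : ℕ → Obs d) :
    record ω (n + 1) = h ↔ record ω n = Fin.init h ∧ ω n = h (Fin.last n) := by
  constructor
  · rintro rfl
    exact ⟨rfl, rfl⟩
  · rintro ⟨h1, h2⟩
    rw [← Fin.snoc_init_self h, ← h1, ← h2]
    funext i
    refine Fin.lastCases ?_ (fun j => ?_) i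
    · simp [record]
    · simp [record]

/-- The two laws of a record differ only through the likelihoods: the selection probabilities are
common to both. The identity is cross-multiplied to avoid dividing by zero. -/
theorem law_record_mul_prod (π : Policy d) (f : Model d) (θ θ' : Param d) (n : ℕ)
    (h : Fin n → Obs d) :
    π.law f θ {ω | record ω n = h} * ∏ k, f θ' (h k).1 (h k).2
      = π.law f θ' {ω | record ω n = h} * ∏ k, f θ (h k).1 (h k).2 := by
  induction n with
  | zero =>
    have e : ∀ ω : ℕ → Obs d, record ω 0 = h := fun ω => Subsingleton.elim _ _
    simp [e]
  | succ n ih =>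
    simp only [record_succ_eq_iff, law_step, next_apply, Fin.prod_univ_castSucc]
    have := ih (Fin.init h)
    simp only [Fin.init] at this ⊢
    calc _ = (π.law f θ {ω | record ω n = Fin.init h}
              * ∏ k : Fin n, f θ' (h k.castSucc).1 (h k.castSucc).2)
              * (π.sel n (Fin.init h) (h (Fin.last n)).1
                * f θ (h (Fin.last n)).1 (h (Fin.last n)).2
                * f θ' (h (Fin.last n)).1 (h (Fin.last n)).2) := by ring
      _ = _ := by rw [this]; ring

/-- A bound on the log-likelihood ratio of a record compares its probabilities under the two
parameters. -/
theorem law_record_le (π : Policy d) (f : Model d) (θ θ' : Param d)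
    (hθ : ∀ a x, 0 < prob f θ a x) (hθ' : ∀ a x, 0 < prob f θ' a x) (n : ℕ)
    (h : Fin n → Obs d) (z : ℝ)
    (hz : ∑ k, (Real.log (prob f θ (h k).1 (h k).2) - Real.log (prob f θ' (h k).1 (h k).2)) ≤ z) :
    π.law f θ {ω | record ω n = h}
      ≤ ENNReal.ofReal (Real.exp z) * π.law f θ' {ω | record ω n = h} := by
  have conv : ∀ θ : Param d, (∀ a x, 0 < prob f θ a x) → ∏ k, f θ (h k).1 (h k).2
      = ENNReal.ofReal (Real.exp (∑ k, Real.log (prob f θ (h k).1 (h k).2))) := by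
    intro θ hθ
    rw [Real.exp_sum, ENNReal.ofReal_prod_of_nonneg (fun _ _ => (Real.exp_pos _).le)]
    refine Finset.prod_congr rfl fun k _ => ?_
    rw [Real.exp_log (hθ _ _), prob, ENNReal.ofReal_toReal (PMF.apply_ne_top _ _)]
  have key := π.law_record_mul_prod f θ θ' n h
  rw [conv θ hθ, conv θ' hθ'] at key
  set A := ∑ k, Real.log (prob f θ (h k).1 (h k).2)
  set B := ∑ k, Real.log (prob f θ' (h k).1 (h k).2)
  have hAB : A ≤ z + B := by
    rw [Finset.sum_sub_distrib] at hz
    linarith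
  have hB : ENNReal.ofReal (Real.exp B) ≠ 0 := by simp [Real.exp_pos]
  refine (ENNReal.mul_le_mul_iff_left hB ENNReal.ofReal_ne_top).1 ?_
  rw [key, mul_right_comm, mul_comm]
  gcongr
  rw [← ENNReal.ofReal_mul (Real.exp_pos _).le, ← Real.exp_add]
  exact ENNReal.ofReal_le_ofReal (Real.exp_le_exp.2 hAB)

theorem time_eq_coe_iff (π : Policy d) (ω : ℕ → Obs d) (n : ℕ) :
    π.time ω = n ↔ record ω n ∈ π.halt n ∧ ∀ m < n, record ω m ∉ π.halt m := by
  constructor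
  · intro h
    have h2 : ∀ m < n, record ω m ∉ π.halt m := by
      intro m hm hmem
      have : π.time ω ≤ m := iInf₂_le m hmem
      rw [h] at this
      exact absurd (Nat.cast_le.1 this) (not_le.2 hm)
    refine ⟨?_, h2⟩
    by_contra hn
    have : ((n + 1 : ℕ) : ℕ∞) ≤ π.time ω := by
      refine le_iInf₂ fun m hm => Nat.cast_le.2 ?_
      by_contra hlt
      rcases (Nat.lt_succ_iff.1 (not_le.1 hlt)).lt_or_eq with h3 | rfl
      · exact h2 m h3 hm
      · exact hn hm
    rw [h] at this
    exact absurd (Nat.cast_le.1 this) (by omega)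
  · rintro ⟨h1, h2⟩
    refine le_antisymm (iInf₂_le n h1) (le_iInf₂ fun m hm => Nat.cast_le.2 ?_)
    by_contra hlt
    exact h2 m (not_le.1 hlt) hm

theorem coe_lt_time_iff (π : Policy d) (ω : ℕ → Obs d) (n : ℕ) :
    (n : ℕ∞) < π.time ω ↔ ∀ m ≤ n, record ω m ∉ π.halt m := by
  constructor
  · intro h m hm hmem
    have : π.time ω ≤ m := iInf₂_le m hmem
    exact absurd (h.trans_le (this.trans (Nat.cast_le.2 hm))) (lt_irrefl _)
  · intro h
    refine lt_of_lt_of_le (Nat.cast_lt.2 n.lt_succ_self) (le_iInf₂ fun m hm => Nat.cast_le.2 ?_)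
    by_contra hlt
    exact h m (by omega) hm

/-- The event that sampling ends after finitely many comparisons and that the record obtained by
then lies in `H`. -/
def stopped (π : Policy d) (H : (n : ℕ) → Set (Fin n → Obs d)) : Set (ℕ → Obs d) :=
  {ω | ∃ n : ℕ, π.time ω = n ∧ record ω n ∈ H n}

/-- The records of length `n` in `H n` at which sampling ends, no earlier halting record having
been met. -/
def haltingRecords (π : Policy d) (H : (n : ℕ) → Set (Fin n → Obs d)) (n : ℕ) :
    Set (Fin n → Obs d) :=
  {h | h ∈ π.halt n ∧ (∀ m (hm : m < n), (fun i : Fin m => h ⟨i, i.2.trans hm⟩) ∉ π.halt m)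
    ∧ h ∈ H n}

theorem record_mem_haltingRecords_iff (π : Policy d) (H : (n : ℕ) → Set (Fin n → Obs d))
    (ω : ℕ → Obs d) (n : ℕ) :
    record ω n ∈ π.haltingRecords H n ↔ π.time ω = n ∧ record ω n ∈ H n := by
  rw [time_eq_coe_iff, and_assoc]
  rfl

theorem stopped_eq_iUnion (π : Policy d) (H : (n : ℕ) → Set (Fin n → Obs d)) :
    π.stopped H = ⋃ n, {ω | record ω n ∈ π.haltingRecords H n} := by
  ext ω
  simp only [stopped, Set.mem_iUnion, Set.mem_ofPred_eq, record_mem_haltingRecords_iff]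

theorem measurableSet_stopped (π : Policy d) (H : (n : ℕ) → Set (Fin n → Obs d)) :
    MeasurableSet (π.stopped H) := by
  rw [stopped_eq_iUnion]
  exact .iUnion fun n => measurableSet_record n _

/-- Domination of the probabilities of single records passes to stopping events, which are
countable disjoint unions of them. -/
theorem law_stopped_le (π : Policy d) (f : Model d) (θ θ' : Param d) (E : ℝ≥0∞)
    (H : (n : ℕ) → Set (Fin n → Obs d))
    (hE : ∀ n, ∀ h ∈ H n, π.law f θ {ω | record ω n = h} ≤ E * π.law f θ' {ω | record ω n = h}) :
    π.law f θ (π.stopped H) ≤ E * π.law f θ' (π.stopped H) := by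
  have disj : Pairwise (Function.onFun Disjoint
      fun n => {ω : ℕ → Obs d | record ω n ∈ π.haltingRecords H n}) := by
    intro m n hmn
    refine Set.disjoint_left.2 fun ω h1 h2 => hmn ?_
    have e1 := ((record_mem_haltingRecords_iff _ _ _ _).1 h1).1
    have e2 := ((record_mem_haltingRecords_iff _ _ _ _).1 h2).1
    exact Nat.cast_injective (R := ℕ∞) (e1.symm.trans e2)
  rw [stopped_eq_iUnion, measure_iUnion disj fun n => measurableSet_record n _,
    measure_iUnion disj fun n => measurableSet_record n _, ← ENNReal.tsum_mul_left]
  refine ENNReal.tsum_le_tsum fun n => ?_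
  have split : ∀ μ : Measure (ℕ → Obs d), μ {ω | record ω n ∈ π.haltingRecords H n}
      = ∑' h : π.haltingRecords H n, μ {ω | record ω n = h} := fun μ =>
    (tsum_measure_preimage_singleton (f := fun ω : ℕ → Obs d => record ω n)
      (π.haltingRecords H n).to_countable fun h _ => measurableSet_record n {h}).symm
  rw [split, split, ← ENNReal.tsum_mul_left]
  exact ENNReal.tsum_le_tsum fun h => hE n h h.2.2.2

/-! ### Stopped martingales -/

theorem exists_eq_comp_record {n : ℕ} {F : (ℕ → Obs d) → ℝ} (hF : DependsOn F (Set.Iio n)) :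
    ∃ φ : (Fin n → Obs d) → ℝ, ∀ ω, F ω = φ (record ω n) := by
  refine ⟨Function.extend (fun ω => record ω n) F 0, fun ω => ?_⟩
  refine (Function.FactorsThrough.extend_apply ?_ _ ω).symm
  intro ω₁ ω₂ h
  exact hF fun i hi => congrFun h ⟨i, hi⟩

theorem integrable_of_dependsOn (π : Policy d) (f : Model d) (θ : Param d) {n : ℕ}
    {F : (ℕ → Obs d) → ℝ} (hF : DependsOn F (Set.Iio n)) : Integrable F (π.law f θ) := by
  obtain ⟨φ, hφ⟩ := exists_eq_comp_record hF
  have : F = φ ∘ fun ω => record ω n := funext hφ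
  rw [this]
  have := Measure.isProbabilityMeasure_map (μ := π.law f θ)
    (measurable_record (d := d) n).aemeasurable
  exact (Integrable.of_finite (f := φ)
    (μ := (π.law f θ).map fun ω => record ω n)).comp_measurable (measurable_record n)

/-- An increment that is centred under every comparison is orthogonal to the past. -/
theorem integral_mul_increment (π : Policy d) (f : Model d) (θ : Param d) {n : ℕ}
    {F : (ℕ → Obs d) → ℝ} (hF : DependsOn F (Set.Iio n)) (ξ : Obs d → ℝ)
    (hξ : ∀ a, ∑ x, prob f θ a x * ξ (a, x) = 0) :
    ∫ ω, F ω * ξ (ω n) ∂(π.law f θ) = 0 := by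
  obtain ⟨φ, hφ⟩ := exists_eq_comp_record hF
  have hm : Measurable fun ω : ℕ → Obs d => (record ω n, ω n) :=
    (measurable_record n).prodMk (measurable_pi_apply n)
  have := Measure.isProbabilityMeasure_map (μ := π.law f θ) hm.aemeasurable
  have h1 : ∫ ω, F ω * ξ (ω n) ∂(π.law f θ)
      = ∫ p, φ p.1 * ξ p.2 ∂((π.law f θ).map fun ω => (record ω n, ω n)) := by
    rw [integral_map hm.aemeasurable (Measurable.of_discrete.aestronglyMeasurable)]
    simp only [hφ]
  have h2 : ∀ p : (Fin n → Obs d) × Obs d,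
      ((π.law f θ).map fun ω => (record ω n, ω n)).real {p}
        = (π.law f θ).real {ω | record ω n = p.1}
          * ((π.sel n p.1 p.2.1).toReal * prob f θ p.2.1 p.2.2) := by
    intro p
    rw [measureReal_def, Measure.map_apply hm (measurableSet_singleton p), prob,
      ← ENNReal.toReal_mul, ← next_apply, measureReal_def, ← ENNReal.toReal_mul, ← law_step]
    congr 2
    ext ω
    simp [Prod.ext_iff]
  rw [h1, integral_fintype .of_finite, Fintype.sum_prod_type]
  refine Finset.sum_eq_zero fun h _ => ?_
  rw [Fintype.sum_prod_type]
  refine Finset.sum_eq_zero fun a _ => ?_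
  simp only [h2, smul_eq_mul]
  calc _ = (π.law f θ).real {ω | record ω n = h} * (π.sel n h a).toReal * φ h
        * ∑ x, prob f θ a x * ξ (a, x) := by
        rw [Finset.mul_sum]
        exact Finset.sum_congr rfl fun x _ => by ring
    _ = 0 := by rw [hξ, mul_zero]

open Classical in
/-- The sum of the increments `ξ` over the first `n` observations, stopped when sampling ends: as
indices start at `0`, the observation with index `k` is made if and only if `k < T`. -/
def stoppedSum (π : Policy d) (ξ : Obs d → ℝ) (n : ℕ) (ω : ℕ → Obs d) : ℝ :=
  ∑ k ∈ Finset.range n, if (k : ℕ∞) < π.time ω then ξ (ω k) else 0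

theorem coe_lt_time_congr (π : Policy d) {n : ℕ} {ω ω' : ℕ → Obs d}
    (h : ∀ i ∈ Set.Iio n, ω i = ω' i) : (n : ℕ∞) < π.time ω ↔ (n : ℕ∞) < π.time ω' := by
  simp only [coe_lt_time_iff]
  refine forall₂_congr fun m hm => ?_
  have : record ω m = record ω' m := funext fun i => h i (i.2.trans_le hm)
  rw [this]

theorem dependsOn_stoppedSum (π : Policy d) (ξ : Obs d → ℝ) (n : ℕ) :
    DependsOn (π.stoppedSum ξ n) (Set.Iio n) := by
  intro ω ω' h
  refine Finset.sum_congr rfl fun k hk => ?_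
  have hk := Finset.mem_range.1 hk
  have h1 := π.coe_lt_time_congr (n := k) (ω := ω) (ω' := ω') fun i hi => h i (lt_trans hi hk)
  simp only [h1, h k hk]

/-- The increments of the stopped sum are orthogonal, because `n < T` is determined by the first
`n` observations. -/
theorem integral_stoppedSum_sq_le (π : Policy d) (f : Model d) (θ : Param d) (ξ : Obs d → ℝ)
    (hξ : ∀ a, ∑ x, prob f θ a x * ξ (a, x) = 0) {b : ℝ} (hb : ∀ o, |ξ o| ≤ b) (n : ℕ) :
    ∫ ω, π.stoppedSum ξ n ω ^ 2 ∂(π.law f θ) ≤ n * b ^ 2 := by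
  classical
  induction n with
  | zero => simp [stoppedSum]
  | succ n ih =>
    have hS := π.dependsOn_stoppedSum ξ n
    set G : (ℕ → Obs d) → ℝ := fun ω => if (n : ℕ∞) < π.time ω then 1 else 0 with hG
    have hGdep : DependsOn G (Set.Iio n) := fun ω ω' h => by
      simp only [hG, π.coe_lt_time_congr h]
    have hexp : ∀ ω, π.stoppedSum ξ (n + 1) ω ^ 2 = π.stoppedSum ξ n ω ^ 2
        + 2 * ((π.stoppedSum ξ n ω * G ω) * ξ (ω n)) + (G ω * ξ (ω n)) ^ 2 := by
      intro ω
      have : π.stoppedSum ξ (n + 1) ω = π.stoppedSum ξ n ω + G ω * ξ (ω n) := by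
        simp [stoppedSum, Finset.sum_range_succ, hG]
      rw [this]
      ring
    have mono : ∀ {i : ℕ}, i ∈ Set.Iio n → i ∈ Set.Iio (n + 1) := fun hi =>
      lt_trans hi n.lt_succ_self
    have i1 : Integrable (fun ω => π.stoppedSum ξ n ω ^ 2) (π.law f θ) :=
      π.integrable_of_dependsOn f θ (n := n) fun ω ω' h => by simp only [hS h]
    have i2 : Integrable (fun ω => 2 * ((π.stoppedSum ξ n ω * G ω) * ξ (ω n))) (π.law f θ) :=
      π.integrable_of_dependsOn f θ (n := n + 1) fun ω ω' h => by
        simp only [hS fun i hi => h i (mono hi), hGdep fun i hi => h i (mono hi),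
          h n n.lt_succ_self]
    have i3 : Integrable (fun ω => (G ω * ξ (ω n)) ^ 2) (π.law f θ) :=
      π.integrable_of_dependsOn f θ (n := n + 1) fun ω ω' h => by
        simp only [hGdep fun i hi => h i (mono hi), h n n.lt_succ_self]
    simp only [hexp]
    have i12 : Integrable (fun ω => π.stoppedSum ξ n ω ^ 2
        + 2 * ((π.stoppedSum ξ n ω * G ω) * ξ (ω n))) (π.law f θ) := i1.add i2
    rw [integral_add i12 i3, integral_add i1 i2, integral_const_mul,
      π.integral_mul_increment f θ (n := n) (F := fun ω => π.stoppedSum ξ n ω * G ω)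
        (fun ω ω' h => by simp only [hS h, hGdep h]) ξ hξ]
    have h3 : ∫ ω, (G ω * ξ (ω n)) ^ 2 ∂(π.law f θ) ≤ b ^ 2 := by
      have : ∫ ω, (G ω * ξ (ω n)) ^ 2 ∂(π.law f θ) ≤ ∫ _ω, b ^ 2 ∂(π.law f θ) := by
        refine integral_mono i3 (integrable_const _) fun ω => ?_
        have hsq : ξ (ω n) ^ 2 ≤ b ^ 2 := sq_le_sq.2 ((hb _).trans (le_abs_self b))
        simp only [hG]
        split_ifs
        · simpa using hsq
        · simpa using sq_nonneg b
      simpa using this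
    push_cast
    linarith

/-- Chebyshev's inequality at the stopping time. -/
theorem law_stopped_sum_gt_le (π : Policy d) (f : Model d) (θ : Param d) (ξ : Obs d → ℝ)
    (hξ : ∀ a, ∑ x, prob f θ a x * ξ (a, x) = 0) {b : ℝ} (hb : ∀ o, |ξ o| ≤ b)
    {τ z : ℝ} (hτ : 0 ≤ τ) (hz : 0 < z) :
    π.law f θ (π.stopped fun n => {h | (n : ℝ) ≤ τ ∧ z < ∑ k, ξ (h k)})
      ≤ ENNReal.ofReal (τ * b ^ 2 / z ^ 2) := by
  set N := ⌊τ⌋₊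
  have hdep := π.dependsOn_stoppedSum ξ N
  have hint : Integrable (fun ω => π.stoppedSum ξ N ω ^ 2) (π.law f θ) :=
    π.integrable_of_dependsOn f θ (n := N) fun ω ω' h => by simp only [hdep h]
  have hcheb := mul_meas_ge_le_integral_of_nonneg (μ := π.law f θ)
    (f := fun ω => π.stoppedSum ξ N ω ^ 2) (.of_forall fun ω => sq_nonneg _) hint (z ^ 2)
  have hsub : π.stopped (fun n => {h | (n : ℝ) ≤ τ ∧ z < ∑ k, ξ (h k)})
      ⊆ {ω | z ^ 2 ≤ π.stoppedSum ξ N ω ^ 2} := by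
    rintro ω ⟨n, hn, hnτ, hlt⟩
    have hnN : n ≤ N := Nat.le_floor hnτ
    have : π.stoppedSum ξ N ω = ∑ k : Fin n, ξ (record ω n k) := by
      unfold stoppedSum
      simp only [hn, Nat.cast_lt]
      rw [← Finset.sum_filter]
      refine Eq.trans ?_ (Fin.sum_univ_eq_sum_range (fun k => ξ (ω k)) n).symm
      congr 1
      ext k
      simp only [Finset.mem_filter, Finset.mem_range]
      omega
    rw [Set.mem_ofPred_eq, this]
    exact pow_le_pow_left₀ hz.le hlt.le 2
  refine (measure_mono hsub).trans ?_
  rw [← ENNReal.ofReal_toReal (measure_ne_top (π.law f θ) {ω | z ^ 2 ≤ π.stoppedSum ξ N ω ^ 2})]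
  refine ENNReal.ofReal_le_ofReal ((le_div_iff₀ (by positivity)).2 ?_)
  have h2 := π.integral_stoppedSum_sq_le f θ ξ hξ hb N
  have h3 : (N : ℝ) * b ^ 2 ≤ τ * b ^ 2 :=
    mul_le_mul_of_nonneg_right (Nat.floor_le hτ) (sq_nonneg b)
  rw [measureReal_def] at hcheb
  linarith

end Policy

/-! ### Divergences and the design value -/

theorem sum_prob (f : Model d) (θ : Param d) (a : Pair d) : ∑ x, prob f θ a x = 1 := by
  have h := (f θ a).tsum_coe
  rw [tsum_fintype] at h
  simp only [prob]
  rw [← ENNReal.toReal_sum fun x _ => PMF.apply_ne_top _ _, h, ENNReal.toReal_one]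

theorem kl_eq_sum_mul_sub {f : Model d} {θ θ' : Param d} (hθ : ∀ a x, 0 < prob f θ a x)
    (hθ' : ∀ a x, 0 < prob f θ' a x) (a : Pair d) :
    kl f a θ θ' = ∑ x, prob f θ a x
      * (Real.log (prob f θ a x) - Real.log (prob f θ' a x)) := by
  refine Finset.sum_congr rfl fun x _ => ?_
  rw [Real.log_div (hθ a x).ne' (hθ' a x).ne']

/-- Gibbs' inequality. -/
theorem kl_nonneg {f : Model d} {θ θ' : Param d} (hθ : ∀ a x, 0 < prob f θ a x)
    (hθ' : ∀ a x, 0 < prob f θ' a x) (a : Pair d) : 0 ≤ kl f a θ θ' := by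
  have h : ∑ x, (prob f θ a x - prob f θ' a x) ≤ kl f a θ θ' := by
    refine Finset.sum_le_sum fun x _ => ?_
    have h1 := Real.one_sub_inv_le_log_of_pos (div_pos (hθ a x) (hθ' a x))
    have h2 := mul_le_mul_of_nonneg_left h1 (hθ a x).le
    have h3 : prob f θ a x * (1 - (prob f θ a x / prob f θ' a x)⁻¹)
        = prob f θ a x - prob f θ' a x := by
      have := (hθ a x).ne'
      field_simp
    linarith
  rw [Finset.sum_sub_distrib, sum_prob, sum_prob, sub_self] at h
  exact h

theorem sum_prob_mul_le (f : Model d) (θ : Param d) (a : Pair d) (g : Bool → ℝ) {η : ℝ}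
    (hg : ∀ x, g x ≤ η) : ∑ x, prob f θ a x * g x ≤ η := by
  calc _ ≤ ∑ x, prob f θ a x * η :=
        Finset.sum_le_sum fun x _ => mul_le_mul_of_nonneg_left (hg x) ENNReal.toReal_nonneg
    _ = η := by rw [← Finset.sum_mul, sum_prob, one_mul]

theorem kl_le_of_log_sub_le {f : Model d} {θ θ' : Param d} (hθ : ∀ a x, 0 < prob f θ a x)
    (hθ' : ∀ a x, 0 < prob f θ' a x) {η : ℝ} (a : Pair d)
    (h : ∀ x, Real.log (prob f θ a x) - Real.log (prob f θ' a x) ≤ η) : kl f a θ θ' ≤ η := by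
  rw [kl_eq_sum_mul_sub hθ hθ']
  exact sum_prob_mul_le f θ a _ h

/-- The divergence from `θ` changes by at most `η` when its second argument moves by `η` in
log-likelihood. -/
theorem kl_le_kl_add {f : Model d} {θ θ₁ θ₂ : Param d} (hθ : ∀ a x, 0 < prob f θ a x)
    (h₁ : ∀ a x, 0 < prob f θ₁ a x) (h₂ : ∀ a x, 0 < prob f θ₂ a x) {η : ℝ} (a : Pair d)
    (h : ∀ x, Real.log (prob f θ₂ a x) - Real.log (prob f θ₁ a x) ≤ η) :
    kl f a θ θ₁ ≤ kl f a θ θ₂ + η := by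
  rw [kl_eq_sum_mul_sub hθ h₁, kl_eq_sum_mul_sub hθ h₂, ← sub_le_iff_le_add',
    ← Finset.sum_sub_distrib]
  refine le_trans (le_of_eq ?_) (sum_prob_mul_le f θ a _ h)
  exact Finset.sum_congr rfl fun x _ => by ring

/-- Finitely many balls cover `W` such that all log-likelihoods oscillate by at most `η` about the
centre on each of them. -/
theorem exists_finite_net {f : Model d} {W : Set (Param d)} (hcompact : IsCompact W)
    (hcont : ∀ a x, ContinuousOn (fun θ => Real.log (prob f θ a x)) W) {η : ℝ} (hη : 0 < η) :
    ∃ (S : Finset (Param d)) (s : Param d → ℝ), (∀ j ∈ S, j ∈ W ∧ 0 < s j) ∧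
      (∀ θ ∈ W, ∃ j ∈ S, θ ∈ Metric.ball j (s j)) ∧
      ∀ j ∈ S, ∀ θ ∈ W, θ ∈ Metric.ball j (s j) → ∀ a x,
        |Real.log (prob f θ a x) - Real.log (prob f j a x)| ≤ η := by
  have hs : ∀ j ∈ W, ∃ s > 0, ∀ θ ∈ W, θ ∈ Metric.ball j s → ∀ a x,
      |Real.log (prob f θ a x) - Real.log (prob f j a x)| ≤ η := by
    intro j hj
    have ev : ∀ᶠ θ in 𝓝[W] j, ∀ a x,
        |Real.log (prob f θ a x) - Real.log (prob f j a x)| ≤ η := by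
      refine eventually_all.2 fun a => eventually_all.2 fun x => ?_
      filter_upwards [Metric.continuousOn_iff'.1 (hcont a x) j hj η hη] with θ hθ
      exact (Real.dist_eq _ _ ▸ hθ).le
    obtain ⟨s, hs, hsub⟩ := Metric.mem_nhdsWithin_iff.1 ev
    exact ⟨s, hs, fun θ hθ hb => hsub ⟨hb, hθ⟩⟩
  choose! s hs0 hs using hs
  obtain ⟨S, hSW, hS⟩ := hcompact.elim_nhds_subcover (fun j => Metric.ball j (s j))
    fun j hj => Metric.ball_mem_nhds j (hs0 j hj)
  refine ⟨S, s, fun j hj => ⟨hSW j hj, hs0 j (hSW j hj)⟩, fun θ hθ => ?_,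
    fun j hj => hs j (hSW j hj)⟩
  simpa using hS hθ

theorem exists_log_prob_bound {f : Model d} {W : Set (Param d)} (hcompact : IsCompact W)
    (hcont : ∀ a x, ContinuousOn (fun θ => Real.log (prob f θ a x)) W) :
    ∃ B : ℝ, 0 < B ∧ ∀ θ ∈ W, ∀ a x, |Real.log (prob f θ a x)| ≤ B := by
  choose B hB using fun a x => hcompact.exists_bound_of_continuousOn (hcont a x)
  refine ⟨1 + ∑ a, ∑ x, |B a x|, by positivity, fun θ hθ a x => ?_⟩
  have h1 : |B a x| ≤ ∑ x, |B a x| :=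
    Finset.single_le_sum (f := fun x => |B a x|) (fun _ _ => abs_nonneg _) (Finset.mem_univ x)
  have h2 : ∑ x, |B a x| ≤ ∑ a, ∑ x, |B a x| :=
    Finset.single_le_sum (f := fun a => ∑ x, |B a x|)
      (fun _ _ => Finset.sum_nonneg fun _ _ => abs_nonneg _) (Finset.mem_univ a)
  have h3 := hB a x θ hθ
  rw [Real.norm_eq_abs] at h3
  linarith [le_abs_self (B a x)]

theorem sum_simplex_mul_le {l g : Pair d → ℝ} (hl : l ∈ stdSimplex ℝ (Pair d)) {η : ℝ}
    (hg : ∀ a, g a ≤ η) : ∑ a, l a * g a ≤ η := by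
  calc _ ≤ ∑ a, l a * η :=
        Finset.sum_le_sum fun a _ => mul_le_mul_of_nonneg_left (hg a) (hl.1 a)
    _ = η := by rw [← Finset.sum_mul, hl.2, one_mul]

theorem nonempty_other_ranking {r : Param d → Equiv.Perm (Fin (d + 1))} {W : Set (Param d)}
    (hd : 1 ≤ d) (hW : ∀ σ, ∃ θ ∈ W, r θ = σ) (θ : Param d) :
    Nonempty {θ' : Param d // θ' ∈ W ∧ r θ' ≠ r θ} := by
  have : Nontrivial (Fin (d + 1)) := Fin.nontrivial_iff_two_le.2 (by omega)
  obtain ⟨σ, hσ⟩ := exists_ne (r θ)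
  obtain ⟨θ', h1, h2⟩ := hW σ
  exact ⟨θ', h1, h2 ▸ hσ⟩

section DesignValue

variable {f : Model d} {r : Param d → Equiv.Perm (Fin (d + 1))} {W : Set (Param d)} {B : ℝ}
  {θ : Param d}

theorem kl_le_two_mul (hpos : ∀ θ ∈ W, ∀ a x, 0 < prob f θ a x)
    (hB : ∀ θ ∈ W, ∀ a x, |Real.log (prob f θ a x)| ≤ B) {θ' : Param d} (hθ : θ ∈ W)
    (hθ' : θ' ∈ W) (a : Pair d) : kl f a θ θ' ≤ 2 * B :=
  kl_le_of_log_sub_le (hpos θ hθ) (hpos θ' hθ') a fun x => by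
    linarith [abs_le.1 (hB θ hθ a x), abs_le.1 (hB θ' hθ' a x)]

theorem bddBelow_information (hpos : ∀ θ ∈ W, ∀ a x, 0 < prob f θ a x) (hθ : θ ∈ W)
    (l : stdSimplex ℝ (Pair d)) :
    BddBelow (Set.range fun θ' : {θ' : Param d // θ' ∈ W ∧ r θ' ≠ r θ} =>
      ∑ a : Pair d, (l : Pair d → ℝ) a * kl f a θ θ') := by
  refine ⟨0, ?_⟩
  rintro _ ⟨θ', rfl⟩
  exact Finset.sum_nonneg fun a _ =>
    mul_nonneg (l.2.1 a) (kl_nonneg (hpos θ hθ) (hpos θ' θ'.2.1) a)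

theorem iInf_information_le (hpos : ∀ θ ∈ W, ∀ a x, 0 < prob f θ a x)
    (hB : ∀ θ ∈ W, ∀ a x, |Real.log (prob f θ a x)| ≤ B) (hθ : θ ∈ W)
    (hne : Nonempty {θ' : Param d // θ' ∈ W ∧ r θ' ≠ r θ}) (l : stdSimplex ℝ (Pair d)) :
    ⨅ θ' : {θ' : Param d // θ' ∈ W ∧ r θ' ≠ r θ}, ∑ a : Pair d, (l : Pair d → ℝ) a * kl f a θ θ'
      ≤ 2 * B := by
  obtain ⟨θ'⟩ := hne
  exact (ciInf_le (bddBelow_information hpos hθ l) θ').trans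
    (sum_simplex_mul_le l.2 fun a => kl_le_two_mul hpos hB hθ θ'.2.1 a)

theorem iInf_information_le_designValue (hpos : ∀ θ ∈ W, ∀ a x, 0 < prob f θ a x)
    (hB : ∀ θ ∈ W, ∀ a x, |Real.log (prob f θ a x)| ≤ B) (hθ : θ ∈ W)
    (hne : Nonempty {θ' : Param d // θ' ∈ W ∧ r θ' ≠ r θ}) (l : stdSimplex ℝ (Pair d)) :
    ⨅ θ' : {θ' : Param d // θ' ∈ W ∧ r θ' ≠ r θ}, ∑ a : Pair d, (l : Pair d → ℝ) a * kl f a θ θ'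
      ≤ designValue f r W θ := by
  refine le_ciSup (f := fun l : stdSimplex ℝ (Pair d) =>
    ⨅ θ' : {θ' : Param d // θ' ∈ W ∧ r θ' ≠ r θ},
      ∑ a : Pair d, (l : Pair d → ℝ) a * kl f a θ θ') ⟨2 * B, ?_⟩ l
  rintro _ ⟨l', rfl⟩
  exact iInf_information_le hpos hB hθ hne l'

/-- No allocation of the comparisons beats the design value: some parameter with another ranking
is nearly that hard to tell apart. -/
theorem exists_information_lt (hpos : ∀ θ ∈ W, ∀ a x, 0 < prob f θ a x)
    (hB : ∀ θ ∈ W, ∀ a x, |Real.log (prob f θ a x)| ≤ B) (hθ : θ ∈ W)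
    (hne : Nonempty {θ' : Param d // θ' ∈ W ∧ r θ' ≠ r θ}) {l : Pair d → ℝ}
    (hl : l ∈ stdSimplex ℝ (Pair d)) {η : ℝ} (hη : 0 < η) :
    ∃ θ' ∈ W, r θ' ≠ r θ ∧ ∑ a, l a * kl f a θ θ' < designValue f r W θ + η := by
  obtain ⟨θ', h⟩ := exists_lt_of_ciInf_lt (lt_of_le_of_lt
    (iInf_information_le_designValue hpos hB hθ hne ⟨l, hl⟩) (lt_add_of_pos_right _ hη))
  exact ⟨θ', θ'.2.1, θ'.2.2, h⟩

theorem designValue_le [Nonempty (Pair d)] (hpos : ∀ θ ∈ W, ∀ a x, 0 < prob f θ a x)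
    (hB : ∀ θ ∈ W, ∀ a x, |Real.log (prob f θ a x)| ≤ B) (hθ : θ ∈ W)
    (hne : Nonempty {θ' : Param d // θ' ∈ W ∧ r θ' ≠ r θ}) :
    designValue f r W θ ≤ 2 * B := by
  classical
  have : Nonempty (stdSimplex ℝ (Pair d)) :=
    ⟨⟨_, single_mem_stdSimplex ℝ (Classical.arbitrary (Pair d))⟩⟩
  exact ciSup_le fun l => iInf_information_le hpos hB hθ hne l

/-- The uniform design keeps the design value away from zero. -/
theorem le_designValue [Nonempty (Pair d)] (hpos : ∀ θ ∈ W, ∀ a x, 0 < prob f θ a x)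
    (hB : ∀ θ ∈ W, ∀ a x, |Real.log (prob f θ a x)| ≤ B) (hθ : θ ∈ W)
    (hne : Nonempty {θ' : Param d // θ' ∈ W ∧ r θ' ≠ r θ}) {ε : ℝ}
    (hsep : ∀ θ' ∈ W, r θ' ≠ r θ → ∃ a, ε ≤ kl f a θ θ') :
    ε / Fintype.card (Pair d) ≤ designValue f r W θ := by
  have hcard : (0 : ℝ) < Fintype.card (Pair d) := Nat.cast_pos.2 Fintype.card_pos
  have hl : (fun _ : Pair d => (Fintype.card (Pair d) : ℝ)⁻¹) ∈ stdSimplex ℝ (Pair d) := by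
    refine ⟨fun _ => by positivity, ?_⟩
    rw [Finset.sum_const, Finset.card_univ, nsmul_eq_mul, mul_inv_cancel₀ hcard.ne']
  refine le_trans ?_ (iInf_information_le_designValue hpos hB hθ hne ⟨_, hl⟩)
  refine le_ciInf fun θ' => ?_
  obtain ⟨a, ha⟩ := hsep θ' θ'.2.1 θ'.2.2
  change _ ≤ ∑ a, (Fintype.card (Pair d) : ℝ)⁻¹ * kl f a θ θ'
  rw [← Finset.mul_sum, div_eq_inv_mul]
  refine mul_le_mul_of_nonneg_left (ha.trans ?_) (by positivity)
  exact Finset.single_le_sum (f := fun a => kl f a θ θ')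
    (fun a _ => kl_nonneg (hpos θ hθ) (hpos θ' θ'.2.1) a) (Finset.mem_univ a)

end DesignValue

/-- Along a record of length `n`, the total information about some parameter with another ranking
is at most `n` times the design value, up to `n η`. -/
theorem exists_sum_kl_le {f : Model d}
    {r : Param d → Equiv.Perm (Fin (d + 1))} {W : Set (Param d)} {B : ℝ} {θ : Param d}
    (hpos : ∀ θ ∈ W, ∀ a x, 0 < prob f θ a x)
    (hB : ∀ θ ∈ W, ∀ a x, |Real.log (prob f θ a x)| ≤ B) (hθ : θ ∈ W)
    (hne : Nonempty {θ' : Param d // θ' ∈ W ∧ r θ' ≠ r θ}) {η : ℝ} (hη : 0 < η) {n : ℕ}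
    (p : Fin n → Pair d) :
    ∃ θ' ∈ W, r θ' ≠ r θ ∧ ∑ k, kl f (p k) θ θ' ≤ n * (designValue f r W θ + η) := by
  classical
  rcases Nat.eq_zero_or_pos n with rfl | hn
  · obtain ⟨θ', h1, h2⟩ := hne
    exact ⟨θ', h1, h2, by simp⟩
  have hn' : (0 : ℝ) < n := Nat.cast_pos.2 hn
  -- the empirical frequencies of the compared pairs form a design
  let l : Pair d → ℝ := fun a => (∑ k, if p k = a then 1 else 0) / n
  have hl : l ∈ stdSimplex ℝ (Pair d) := by
    refine ⟨fun a => div_nonneg (Finset.sum_nonneg fun k _ => by split_ifs <;> norm_num) hn'.le, ?_⟩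
    simp only [l]
    rw [← Finset.sum_div, Finset.sum_comm]
    simp [hn'.ne']
  obtain ⟨θ', h1, h2, h3⟩ := exists_information_lt hpos hB hθ hne hl hη
  refine ⟨θ', h1, h2, ?_⟩
  have : ∑ k, kl f (p k) θ θ' = n * ∑ a, l a * kl f a θ θ' := by
    simp only [l, Finset.mul_sum, div_mul_eq_mul_div, mul_div_cancel₀ _ hn'.ne', Finset.sum_mul]
    rw [Finset.sum_comm]
    simp
  rw [this]
  exact mul_le_mul_of_nonneg_left h3.le hn'.le

/-! ### Rankings and ties -/

/-- In the absence of ties, the ranking depends only on the order of the scores. -/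
theorem eq_of_score_lt_iff {r : Param d → Equiv.Perm (Fin (d + 1))} (hr : IsRankMap r)
    {θ θ' : Param d} (hθ : Function.Injective (score θ)) (hθ' : Function.Injective (score θ'))
    (h : ∀ i j, score θ i < score θ j → score θ' i < score θ' j) : r θ' = r θ := by
  have hstrict : StrictAnti fun k => score θ' (r θ k) := fun k l hkl =>
    h _ _ (((hr θ).strictAnti_of_injective (hθ.comp (r θ).injective)) hkl)
  have hstrict' : StrictAnti fun k => score θ' (r θ' k) :=
    (hr θ').strictAnti_of_injective (hθ'.comp (r θ').injective)
  have hrange : Set.range (fun k => OrderDual.toDual (score θ' (r θ' k)))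
      = Set.range (fun k => OrderDual.toDual (score θ' (r θ k))) := by
    have e := fun σ : Equiv.Perm (Fin (d + 1)) =>
      σ.surjective.range_comp fun i => OrderDual.toDual (score θ' i)
    exact (e (r θ')).trans (e (r θ)).symm
  have key := (StrictMono.range_inj hstrict'.dual_right hstrict.dual_right).1 hrange
  exact Equiv.ext fun k => hθ' (congrFun key k)

/-- A ranking without inversions orders the items as the scores do, a smaller rank being better.
-/
theorem score_lt_iff_of_kendall_eq_zero {θ : Param d} {R : Equiv.Perm (Fin (d + 1))}
    (hθ : Function.Injective (score θ)) (h : kendall θ R = 0) (i j : Fin (d + 1)) (hij : i ≠ j) :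
    score θ i < score θ j ↔ R j < R i := by
  have hlt : ∀ i j : Fin (d + 1), i < j → (score θ j < score θ i ↔ R i < R j) := by
    intro i j hij
    have h0 := (Finset.sum_eq_zero_iff.1 h) ⟨(i, j), hij⟩ (Finset.mem_univ _)
    have hne : score θ i ≠ score θ j := fun e => hij.ne (hθ e)
    rw [Nat.add_eq_zero_iff] at h0
    simp only [ite_eq_right_iff, one_ne_zero, imp_false, not_and, not_not] at h0
    constructor
    · exact h0.1
    · intro hR
      by_contra hn
      exact h0.2 (lt_of_le_of_ne (not_lt.1 hn) hne) hR
  rcases lt_or_gt_of_ne hij with hl | hl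
  · have h1 := hlt i j hl
    have hne : score θ i ≠ score θ j := fun e => hij (hθ e)
    have hRne : R i ≠ R j := fun e => hij (R.injective e)
    constructor
    · intro h2
      exact lt_of_le_of_ne (not_lt.1 fun h3 => lt_asymm h2 (h1.2 h3)) hRne.symm
    · intro h2
      exact lt_of_le_of_ne (not_lt.1 fun h3 => lt_asymm h2 (h1.1 h3)) hne
  · exact hlt j i hl

/-- A ranking cannot be free of inversions for two parameters with different rankings. -/
theorem one_le_kendall {r : Param d → Equiv.Perm (Fin (d + 1))} (hr : IsRankMap r)
    {θ θ' : Param d} (hθ : Function.Injective (score θ)) (hθ' : Function.Injective (score θ'))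
    (hne : r θ' ≠ r θ) {R : Equiv.Perm (Fin (d + 1))} (h : kendall θ R = 0) :
    1 ≤ kendall θ' R := by
  by_contra hlt
  have h' : kendall θ' R = 0 := by omega
  refine hne (eq_of_score_lt_iff hr hθ hθ' fun i j hij => ?_)
  have hij' : i ≠ j := fun e => by simp [e] at hij
  exact (score_lt_iff_of_kendall_eq_zero hθ' h' i j hij').2
    ((score_lt_iff_of_kendall_eq_zero hθ h i j hij').1 hij)

/-- Ties between two given items are Lebesgue-null. -/
theorem volume_score_eq (i j : Fin (d + 1)) (hij : i ≠ j) :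
    volume {θ : Param d | score θ i = score θ j} = 0 := by
  have lin : ∀ k : Fin (d + 1), ∃ L : Param d →ₗ[ℝ] ℝ, ∀ θ, L θ = score θ k := by
    intro k
    refine Fin.cases ⟨0, fun θ => rfl⟩ (fun m => ⟨(EuclideanSpace.proj m).toLinearMap, ?_⟩) k
    intro θ
    simp [score]
  obtain ⟨L, hL⟩ := lin i
  obtain ⟨M, hM⟩ := lin j
  have hne : LinearMap.ker (L - M) ≠ ⊤ := by
    intro htop
    have hall : ∀ θ : Param d, score θ i = score θ j := by
      intro θ
      have := LinearMap.mem_ker.1 (htop ▸ Submodule.mem_top : θ ∈ LinearMap.ker (L - M))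
      rw [LinearMap.sub_apply, hL, hM, sub_eq_zero] at this
      exact this
    -- the scores `0, 1, …, d` have no ties
    have h0 := hall (WithLp.toLp 2 fun m : Fin d => ((m : ℕ) : ℝ) + 1)
    have hs : ∀ k : Fin (d + 1),
        score (WithLp.toLp 2 fun m : Fin d => ((m : ℕ) : ℝ) + 1 : Param d) k = ((k : ℕ) : ℝ) := by
      intro k
      refine Fin.cases (by simp [score]) (fun m => by simp [score]) k
    rw [hs, hs] at h0
    exact hij (Fin.ext (Nat.cast_injective h0))
  have := Measure.addHaar_submodule volume (LinearMap.ker (L - M)) hne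
  convert this using 2
  ext θ
  simp [hL, hM, sub_eq_zero]

/-- Almost every parameter lies in the support and has no ties. -/
theorem ae_prior (ρ : Param d → ℝ) (hρ : Measurable ρ) :
    ∀ᵐ θ ∂(prior ρ), θ ∈ densitySupport ρ ∧ Function.Injective (score θ) := by
  refine Filter.Eventually.and ?_ ?_
  · rw [prior, ae_withDensity_iff (by fun_prop)]
    refine .of_forall fun θ hθ => subset_closure ?_
    by_contra hn
    exact hθ (ENNReal.ofReal_eq_zero.2 (not_lt.1 hn))
  · refine (withDensity_absolutelyContinuous _ _).ae_le ?_
    have : ∀ᵐ θ : Param d, ∀ i j : Fin (d + 1), i ≠ j → score θ i ≠ score θ j := by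
      refine ae_all_iff.2 fun i => ae_all_iff.2 fun j => ?_
      by_cases hij : i = j
      · exact .of_forall fun θ h => absurd hij h
      · filter_upwards [measure_eq_zero_iff_ae_notMem.1 (volume_score_eq (d := d) i j hij)]
          with θ hθ _ using hθ
    filter_upwards [this] with θ hθ i j hij
    by_contra hne
    exact hθ i j hne hij

theorem isProbabilityMeasure_prior {ρ : Param d → ℝ}
    (h : ∫⁻ θ, ENNReal.ofReal (ρ θ) = 1) : IsProbabilityMeasure (prior ρ) :=
  ⟨by rw [prior, withDensity_apply _ MeasurableSet.univ, setLIntegral_univ, h]⟩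

/-! ### The risk under a fixed parameter -/

namespace Policy

/-- The expected total cost of a policy under a fixed parameter. -/
def risk (π : Policy d) (f : Model d) (c : ℝ) (θ : Param d) : ℝ≥0∞ :=
  ∫⁻ ω, ((kendall θ (π.decision ω) : ℝ≥0∞)
    + ENNReal.ofReal c * ((π.time ω : ℕ∞) : ℝ≥0∞)) ∂(π.law f θ)

theorem decision_eq (π : Policy d) {ω : ℕ → Obs d} {n : ℕ} (h : π.time ω = n) :
    π.decision ω = π.dec n (record ω n) := by
  unfold decision
  rw [h, ENat.toNat_natCast]

/-- Markov's inequality for the cost. -/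
theorem mul_law_le_risk (π : Policy d) (f : Model d) (θ : Param d) {c : ℝ} {v : ℝ≥0∞}
    {A : Set (ℕ → Obs d)} (hA : MeasurableSet A)
    (h : ∀ ω ∈ A, v ≤ (kendall θ (π.decision ω) : ℝ≥0∞)
      + ENNReal.ofReal c * ((π.time ω : ℕ∞) : ℝ≥0∞)) :
    v * π.law f θ A ≤ π.risk f c θ := by
  rw [← setLIntegral_const]
  refine le_trans (lintegral_mono_ae ?_) (setLIntegral_le_lintegral A _)
  filter_upwards [ae_restrict_mem hA] with ω hω using h ω hω

/-- If sampling rarely ends by time `τ` without an inversion, the risk is about `c τ` at least. -/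
theorem ofReal_mul_one_sub_le_risk (π : Policy d) (f : Model d) (θ : Param d) {c τ : ℝ}
    (hc : 0 < c) (hcτ : c * τ ≤ 1) {q : ℝ≥0∞}
    (hq : π.law f θ (π.stopped fun n => {h | (n : ℝ) ≤ τ ∧ kendall θ (π.dec n h) = 0}) ≤ q) :
    ENNReal.ofReal (c * τ) * (1 - q) ≤ π.risk f c θ := by
  set Q := π.stopped fun n => {h | (n : ℝ) ≤ τ ∧ kendall θ (π.dec n h) = 0} with hQ
  have hQm : MeasurableSet Q := π.measurableSet_stopped _
  refine le_trans ?_ (π.mul_law_le_risk f θ (v := ENNReal.ofReal (c * τ)) hQm.compl ?_)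
  · rw [prob_compl_eq_one_sub hQm]
    gcongr
  · intro ω hω
    cases htime : π.time ω with
    | top => simp [hc]
    | coe n =>
      by_cases hk : kendall θ (π.decision ω) = 0
      · have hn : τ < n := by
          by_contra hle
          exact hω ⟨n, htime, not_lt.1 hle, π.decision_eq htime ▸ hk⟩
        refine le_add_left ?_
        rw [ENNReal.ofReal_mul hc.le, ENat.toENNReal_coe, ← ENNReal.ofReal_natCast]
        gcongr
      · refine le_add_right ?_
        have h1 : (1 : ℝ≥0∞) ≤ (kendall θ (π.decision ω) : ℝ≥0∞) := by
          exact_mod_cast Nat.one_le_iff_ne_zero.2 hk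
        exact le_trans (by simpa using hcτ) h1

theorem bayesRisk_eq (π : Policy d) (f : Model d) (ρ : Param d → ℝ) (c : ℝ) :
    bayesRisk f ρ c π = ∫⁻ θ, π.risk f c θ ∂(prior ρ) := rfl

/-- Change of measure: a stopping event on which the decision is wrong for every parameter near
`j`, and on which the likelihood ratios to these parameters are at most `exp z`, is as unlikely
as the Bayes risk forces it to be. -/
theorem law_stopped_mul_prior_ball_le (π : Policy d) {f : Model d} {ρ : Param d → ℝ}
    {W : Set (Param d)}
    (hae : ∀ᵐ θ ∂(prior ρ), θ ∈ W ∧ Function.Injective (score θ))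
    (hpos : ∀ θ ∈ W, ∀ a x, 0 < prob f θ a x)
    {θ j : Param d} (hθ : θ ∈ W) {s c z : ℝ}
    (H : (n : ℕ) → Set (Fin n → Obs d))
    (hH : ∀ n, ∀ h ∈ H n, ∀ θ' ∈ W, θ' ∈ Metric.ball j s →
      Function.Injective (score θ') → 1 ≤ kendall θ' (π.dec n h) ∧
      ∑ k, (Real.log (prob f θ (h k).1 (h k).2) - Real.log (prob f θ' (h k).1 (h k).2)) ≤ z) :
    π.law f θ (π.stopped H) * prior ρ (Metric.ball j s)
      ≤ ENNReal.ofReal (Real.exp z) * bayesRisk f ρ c π := by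
  rw [bayesRisk_eq, ← setLIntegral_const, ← lintegral_const_mul' _ _ ENNReal.ofReal_ne_top]
  refine le_trans (lintegral_mono_ae ?_) (setLIntegral_le_lintegral (Metric.ball j s) _)
  filter_upwards [ae_restrict_mem Metric.isOpen_ball.measurableSet,
    ae_restrict_of_ae hae] with θ' hb hW
  refine (π.law_stopped_le f θ θ' (ENNReal.ofReal (Real.exp z)) H fun n h hh => ?_).trans ?_
  · exact π.law_record_le f θ θ' (hpos θ hθ) (hpos θ' hW.1) n h z (hH n h hh θ' hW.1 hb hW.2).2
  · gcongr
    have := π.mul_law_le_risk f θ' (c := c) (v := 1) (π.measurableSet_stopped H) ?_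
    · simpa using this
    · rintro ω ⟨n, hn, hmem⟩
      refine le_add_right ?_
      rw [π.decision_eq hn]
      exact_mod_cast (hH n _ hmem θ' hW.1 hb hW.2).1

/-- The centred log-likelihood ratio of one observation between `θ` and `j`. -/
def llrNoise (f : Model d) (θ j : Param d) (o : Obs d) : ℝ :=
  Real.log (prob f θ o.1 o.2) - Real.log (prob f j o.1 o.2) - kl f o.1 θ j

theorem sum_prob_mul_llrNoise {f : Model d} {θ j : Param d} (hθ : ∀ a x, 0 < prob f θ a x)
    (hj : ∀ a x, 0 < prob f j a x) (a : Pair d) :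
    ∑ x, prob f θ a x * llrNoise f θ j (a, x) = 0 := by
  simp only [llrNoise, mul_sub (prob f θ a _), Finset.sum_sub_distrib]
  rw [← Finset.sum_mul, sum_prob, one_mul, kl_eq_sum_mul_sub hθ hj]
  simp only [mul_sub, Finset.sum_sub_distrib, sub_self]

theorem abs_llrNoise_le {f : Model d} {W : Set (Param d)} {B : ℝ}
    (hpos : ∀ θ ∈ W, ∀ a x, 0 < prob f θ a x)
    (hB : ∀ θ ∈ W, ∀ a x, |Real.log (prob f θ a x)| ≤ B) {θ j : Param d} (hθ : θ ∈ W)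
    (hj : j ∈ W) (o : Obs d) : |llrNoise f θ j o| ≤ 4 * B := by
  have h1 := abs_le.1 (hB θ hθ o.1 o.2)
  have h2 := abs_le.1 (hB j hj o.1 o.2)
  have h3 := kl_le_two_mul hpos hB hθ hj o.1
  have h4 := kl_nonneg (hpos θ hθ) (hpos j hj) o.1
  rw [llrNoise, abs_le]
  constructor <;> linarith

/-- Under any policy, sampling ends by time `(1 - δ) L / D(θ)` without an inversion only if a
random fluctuation of the log-likelihood ratio occurs, or if some parameter with another ranking
is still plausible. -/
theorem law_stopped_early_le (π : Policy d) {f : Model d} {ρ : Param d → ℝ}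
    [IsProbabilityMeasure (prior ρ)] {r : Param d → Equiv.Perm (Fin (d + 1))} (hr : IsRankMap r)
    {W : Set (Param d)}
    (hae : ∀ᵐ θ ∂(prior ρ), θ ∈ W ∧ Function.Injective (score θ))
    (hpos : ∀ θ ∈ W, ∀ a x, 0 < prob f θ a x) {B : ℝ}
    (hB : ∀ θ ∈ W, ∀ a x, |Real.log (prob f θ a x)| ≤ B)
    {S : Finset (Param d)} {s : Param d → ℝ} {η : ℝ} (hη : 0 < η)
    (hS : ∀ j ∈ S, j ∈ W) (hball : ∀ j ∈ S, 0 < prior ρ (Metric.ball j (s j)))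
    (hcover : ∀ θ ∈ W, ∃ j ∈ S, θ ∈ Metric.ball j (s j))
    (hnet : ∀ j ∈ S, ∀ θ ∈ W, θ ∈ Metric.ball j (s j) → ∀ a x,
      |Real.log (prob f θ a x) - Real.log (prob f j a x)| ≤ η)
    (hconst : ∀ j ∈ S, ∀ θ ∈ W, θ ∈ Metric.ball j (s j) → r θ = r j)
    {θ : Param d} (hθ : θ ∈ W) (hinj : Function.Injective (score θ))
    (hne : Nonempty {θ' : Param d // θ' ∈ W ∧ r θ' ≠ r θ})
    {δ L c : ℝ} (hδ : 0 < δ) (hδ1 : δ < 1) (hL : 0 < L)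
    (hD : 0 < designValue f r (W) θ)
    (hηD : 6 * η ≤ δ * designValue f r (W) θ) {τ : ℝ}
    (hτ : τ = (1 - δ) * (L / designValue f r (W) θ)) :
    π.law f θ (π.stopped fun n => {h | (n : ℝ) ≤ τ ∧ kendall θ (π.dec n h) = 0})
      ≤ ∑ j ∈ S, (ENNReal.ofReal (τ * (4 * B) ^ 2 / (δ / 4 * L) ^ 2)
        + ENNReal.ofReal (Real.exp ((1 - δ / 4) * L)) * bayesRisk f ρ c π
          / prior ρ (Metric.ball j (s j))) := by
  set D := designValue f r (W) θ with hDdef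
  have hτ0 : 0 ≤ τ := hτ ▸ mul_nonneg (by linarith) (div_pos hL hD).le
  have hτD : τ * (D + 3 * η) ≤ (1 - δ / 2) * L := by
    calc τ * (D + 3 * η) ≤ τ * (D + δ / 2 * D) := by
          refine mul_le_mul_of_nonneg_left ?_ hτ0
          linarith
      _ = (1 - δ) * (1 + δ / 2) * L := by
          rw [hτ]
          field_simp
      _ ≤ (1 - δ / 2) * L := by
          refine mul_le_mul_of_nonneg_right ?_ hL.le
          nlinarith
  -- `H₁ j`: the noise of the log-likelihood ratio against `j` is large
  let H₁ : Param d → (n : ℕ) → Set (Fin n → Obs d) := fun j n =>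
    {h | (n : ℝ) ≤ τ ∧ δ / 4 * L < ∑ k, llrNoise f θ j (h k)}
  -- `H₂ j`: all parameters near `j` are plausible although the decision is wrong for them; the term
  -- `n * η` pays for the passage from `j` to its neighbours
  let H₂ : Param d → (n : ℕ) → Set (Fin n → Obs d) := fun j n =>
    {h | kendall θ (π.dec n h) = 0 ∧ r j ≠ r θ ∧
      ∑ k, (Real.log (prob f θ (h k).1 (h k).2) - Real.log (prob f j (h k).1 (h k).2)) + n * η
        ≤ (1 - δ / 4) * L}
  have hsub : π.stopped (fun n => {h | (n : ℝ) ≤ τ ∧ kendall θ (π.dec n h) = 0})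
      ⊆ ⋃ j ∈ S, (π.stopped (H₁ j) ∪ π.stopped (H₂ j)) := by
    rintro ω ⟨n, hn, hnτ, hk⟩
    obtain ⟨θ', hθ', hrθ', hsum⟩ := exists_sum_kl_le hpos hB hθ hne hη
      fun k => (record ω n k).1
    obtain ⟨j, hj, hθ'j⟩ := hcover θ' hθ'
    refine Set.mem_iUnion₂.2 ⟨j, hj, ?_⟩
    by_cases hz : δ / 4 * L < ∑ k, llrNoise f θ j (record ω n k)
    · exact Or.inl ⟨n, hn, hnτ, hz⟩
    · refine Or.inr ⟨n, hn, hk, hconst j hj θ' hθ' hθ'j ▸ hrθ', ?_⟩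
      have hkl : ∑ k, kl f (record ω n k).1 θ j
          ≤ ∑ k, kl f (record ω n k).1 θ θ' + n * η := by
        calc _ ≤ ∑ k, (kl f (record ω n k).1 θ θ' + η) :=
              Finset.sum_le_sum fun k _ => kl_le_kl_add (hpos θ hθ) (hpos j (hS j hj))
                (hpos θ' hθ') _ fun x => (le_abs_self _).trans (hnet j hj θ' hθ' hθ'j _ x)
          _ = _ := by
              rw [Finset.sum_add_distrib]
              simp
      have hnD : n * (D + 3 * η) ≤ τ * (D + 3 * η) :=
        mul_le_mul_of_nonneg_right hnτ (by positivity)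
      simp only [llrNoise, Finset.sum_sub_distrib] at hz ⊢
      rw [← hDdef] at hsum
      linarith [not_lt.1 hz]
  refine (measure_mono hsub).trans ((measure_biUnion_finset_le S _).trans
    (Finset.sum_le_sum fun j hj => (measure_union_le _ _).trans (add_le_add ?_ ?_)))
  · exact π.law_stopped_sum_gt_le f θ (llrNoise f θ j)
      (sum_prob_mul_llrNoise (hpos θ hθ) (hpos j (hS j hj)))
      (abs_llrNoise_le hpos hB hθ (hS j hj)) hτ0 (by positivity)
  · have key := π.law_stopped_mul_prior_ball_le (f := f) (j := j) (s := s j) (c := c)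
      (z := (1 - δ / 4) * L) hae hpos hθ (H₂ j) ?_
    · exact (ENNReal.le_div_iff_mul_le (.inl (hball j hj).ne') (.inl (measure_ne_top _ _))).2 key
    · rintro n h ⟨hk, hrj, hsum⟩ θ' hθ' hb hinj'
      have hr' := hconst j hj θ' hθ' hb
      refine ⟨one_le_kendall hr hinj hinj' (hr' ▸ hrj) hk, le_trans ?_ hsum⟩
      have : (n : ℝ) * η = ∑ _k : Fin n, η := by simp
      rw [this, ← Finset.sum_add_distrib]
      refine Finset.sum_le_sum fun k _ => ?_
      have := (abs_le.1 (hnet j hj θ' hθ' hb (h k).1 (h k).2)).1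
      linarith

end Policy

/-! ### The asymptotic lower bound -/

/-- The bound for the probability of stopping early without an inversion vanishes with `c`. -/
theorem tendsto_early_bound (S : Finset (Param d)) (p : Param d → ℝ) {δ : ℝ} (hδ : 0 < δ)
    (D₀ B : ℝ) :
    Tendsto (fun c : ℝ => ∑ j ∈ S, (-Real.log c / D₀ * (4 * B) ^ 2 / (δ / 4 * -Real.log c) ^ 2
      + Real.exp ((1 - δ / 4) * -Real.log c) * (c * (-Real.log c / D₀)) / p j))
      (𝓝[>] 0) (𝓝 0) := by
  have hlog : Tendsto (fun c : ℝ => (-Real.log c)⁻¹) (𝓝[>] 0) (𝓝 0) :=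
    tendsto_inv_atTop_zero.comp (tendsto_neg_atBot_atTop.comp Real.tendsto_log_nhdsGT_zero)
  have hpow : Tendsto (fun c : ℝ => Real.log c * c ^ (δ / 4)) (𝓝[>] 0) (𝓝 0) :=
    tendsto_log_mul_rpow_nhdsGT_zero (by positivity)
  rw [show (𝓝 (0 : ℝ)) = 𝓝 (∑ _j ∈ S, 0) by rw [Finset.sum_const_zero]]
  refine tendsto_finsetSum S fun j _ => ?_
  have h := (hlog.mul_const ((4 * B) ^ 2 / D₀ / (δ / 4) ^ 2)).add
    (hpow.mul_const (-1 / (D₀ * p j)))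
  simp only [zero_mul, add_zero] at h
  refine h.congr' ?_
  filter_upwards [Ioo_mem_nhdsGT (zero_lt_one (α := ℝ))] with c hc
  have hL : Real.log c ≠ 0 := (Real.log_neg hc.1 hc.2).ne
  have he : Real.exp ((1 - δ / 4) * -Real.log c) * c = c ^ (δ / 4) := by
    nth_rewrite 2 [← Real.exp_log hc.1]
    rw [← Real.exp_add, Real.rpow_def_of_pos hc.1]
    ring_nf
  rw [← he]
  congr 1
  · by_cases hD : D₀ = 0
    · simp [hD]
    field_simp
  · by_cases hD : D₀ = 0
    · simp [hD]
    by_cases hp : p j = 0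
    · simp [hp]
    field_simp

theorem tc_eq {f : Model d} {r : Param d → Equiv.Perm (Fin (d + 1))} {W : Set (Param d)}
    {c : ℝ} {θ : Param d} (hc : c ∈ Set.Ioo (0 : ℝ) 1) (hD : 0 < designValue f r W θ) :
    tc f r W c θ = ENNReal.ofReal (-Real.log c / designValue f r W θ) := by
  rw [tc, abs_of_neg (Real.log_neg hc.1 hc.2), ENNReal.ofReal_div_of_pos hD]

end RankAgg

end

theorem theorem1 (d : ℕ) (hd : 1 ≤ d)
    (f : RankAgg.Model d)
    (r : RankAgg.Param d → Equiv.Perm (Fin (d + 1))) (hr : RankAgg.IsRankMap r)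
    (ρ : RankAgg.Param d → ℝ) (hρ_meas : Measurable ρ) (hρ_nonneg : ∀ θ, 0 ≤ ρ θ)
    (hρ_one : ∫⁻ θ, ENNReal.ofReal (ρ θ) = 1)
    (W : Set (RankAgg.Param d)) (hW : W = RankAgg.densitySupport ρ)
    -- `W` is the support of the prior law
    (hsupp : ∀ θ ∈ W, ∀ s > 0, 0 < RankAgg.prior ρ (Metric.ball θ s))
    -- compact support, in which every ranking has interior points
    (hcompact : IsCompact W)
    (hint : ∀ σ : Equiv.Perm (Fin (d + 1)), (interior ({θ | r θ = σ} ∩ W)).Nonempty)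
    -- the support is not singular
    (hreg : ∃ δ : ℝ, 0 < δ ∧ ∀ θ ∈ W, ∀ s : ℝ, 0 < s →
      ENNReal.ofReal (min (δ * s ^ d) 1) ≤ volume (Metric.ball θ s ∩ W))
    -- positive likelihood whose logarithm is continuously differentiable, uniformly on `W`
    (hpos : ∀ θ ∈ W, ∀ a x, 0 < RankAgg.prob f θ a x)
    (hsmooth : ∀ θ ∈ W, ∀ a x, ContDiffAt ℝ 1 (fun θ' => Real.log (RankAgg.prob f θ' a x)) θ)
    (hgrad : ∃ κ : ℝ, ∀ θ ∈ W, ∀ a x,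
      ‖gradient (fun θ' => Real.log (RankAgg.prob f θ' a x)) θ‖ ≤ κ)
    -- indifference zone
    (hsep : ∃ ε : ℝ, 0 < ε ∧ ∀ θ ∈ W, ∀ θ' ∈ W, r θ' ≠ r θ → ∃ a, ε ≤ RankAgg.kl f a θ θ')
    -- density bounded away from zero on the interior of `W` and bounded above
    (hρ_low : ∃ m : ℝ, 0 < m ∧ ∀ θ ∈ interior W, m ≤ ρ θ)
    (hρ_up : ∃ M : ℝ, ∀ θ ∈ W, ρ θ ≤ M) :
    1 ≤ liminf (fun c : ℝ => RankAgg.minRisk f ρ c /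
        (ENNReal.ofReal c * ∫⁻ θ, RankAgg.tc f r W c θ ∂(RankAgg.prior ρ)))
      (𝓝[>] 0) := by
  have hpair : Nonempty (RankAgg.Pair d) :=
    ⟨⟨(0, Fin.last d), by
      rw [Fin.lt_def]
      simpa using Nat.lt_of_lt_of_le Nat.zero_lt_one hd⟩⟩
  have hprob := RankAgg.isProbabilityMeasure_prior hρ_one
  have hcont : ∀ a x, ContinuousOn (fun θ => Real.log (RankAgg.prob f θ a x)) W :=
    fun a x θ hθ => (hsmooth θ hθ a x).continuousAt.continuousWithinAt
  obtain ⟨B, hB0, hB⟩ := RankAgg.exists_log_prob_bound hcompact hcont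
  obtain ⟨ε, hε, hsep⟩ := hsep
  have hne := fun θ => RankAgg.nonempty_other_ranking (r := r) (W := W) hd (fun σ => by
    obtain ⟨θ, hθ⟩ := hint σ
    exact ⟨θ, (interior_subset hθ).2, (interior_subset hθ).1⟩) θ
  set D₀ : ℝ := ε / Fintype.card (RankAgg.Pair d) with hD₀
  have hD₀pos : 0 < D₀ := div_pos hε (Nat.cast_pos.2 Fintype.card_pos)
  have hDle : ∀ θ ∈ W, D₀ ≤ RankAgg.designValue f r W θ := fun θ hθ =>
    RankAgg.le_designValue hpos hB hθ (hne θ) (hsep θ hθ)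
  have hDub : ∀ θ ∈ W, RankAgg.designValue f r W θ ≤ 2 * B := fun θ hθ =>
    RankAgg.designValue_le hpos hB hθ (hne θ)
  have hae : ∀ᵐ θ ∂(RankAgg.prior ρ), θ ∈ W ∧ Function.Injective (RankAgg.score θ) :=
    hW ▸ RankAgg.ae_prior ρ hρ_meas
  -- up to a factor `(1 - δ) ^ 2`, the bound holds for all small `c`
  have main : ∀ δ : ℝ, 0 < δ → δ < 1 → ENNReal.ofReal ((1 - δ) ^ 2)
      ≤ liminf (fun c : ℝ => RankAgg.minRisk f ρ c /
        (ENNReal.ofReal c * ∫⁻ θ, RankAgg.tc f r W c θ ∂(RankAgg.prior ρ))) (𝓝[>] 0) := by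
    intro δ hδ hδ1
    -- `η ≤ δ D₀ / 6` is what the information budget tolerates, and `η < ε` keeps the ranking
    -- constant on the balls of the net
    set η : ℝ := min (δ * D₀ / 6) (ε / 3) with hη_def
    have hη : 0 < η := lt_min (by positivity) (by positivity)
    have hη1 : 6 * η ≤ δ * D₀ := by linarith [min_le_left (δ * D₀ / 6) (ε / 3)]
    have hη2 : η < ε := by linarith [min_le_right (δ * D₀ / 6) (ε / 3)]
    obtain ⟨S, s, hS, hcover, hnet⟩ := RankAgg.exists_finite_net hcompact hcont hη
    -- parameters in one ball of the net are too close to have different rankings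
    have hconst : ∀ j ∈ S, ∀ θ ∈ W, θ ∈ Metric.ball j (s j) → r θ = r j := by
      intro j hj θ hθ hb
      by_contra hr'
      obtain ⟨a, ha⟩ := hsep j (hS j hj).1 θ hθ hr'
      have := RankAgg.kl_le_of_log_sub_le (hpos j (hS j hj).1) (hpos θ hθ) (η := η) a fun x => by
        linarith [(abs_le.1 (hnet j hj θ hθ hb a x)).1]
      linarith
    have hball : ∀ j ∈ S, 0 < RankAgg.prior ρ (Metric.ball j (s j)) := fun j hj =>
      hsupp j (hS j hj).1 (s j) (hS j hj).2
    have hball' : ∀ j ∈ S, 0 < (RankAgg.prior ρ (Metric.ball j (s j))).toReal := fun j hj =>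
      ENNReal.toReal_pos (hball j hj).ne' (measure_ne_top _ _)
    have hq := RankAgg.tendsto_early_bound S
      (fun j => (RankAgg.prior ρ (Metric.ball j (s j))).toReal) hδ D₀ B
    have hcL : Tendsto (fun c : ℝ => Real.log c * c ^ (1 : ℝ)) (𝓝[>] 0) (𝓝 0) :=
      tendsto_log_mul_rpow_nhdsGT_zero one_pos
    refine le_liminf_of_le (by isBoundedDefault) ?_
    filter_upwards [Ioo_mem_nhdsGT (zero_lt_one (α := ℝ)), hq.eventually_le_const hδ,
      hcL.eventually_const_le (neg_lt_zero.2 hD₀pos)] with c hc hqc hcLc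
    rw [Real.rpow_one] at hcLc
    set L : ℝ := -Real.log c with hL_def
    have hL : 0 < L := neg_pos.2 (Real.log_neg hc.1 hc.2)
    set X : ℝ≥0∞ := ∫⁻ θ, RankAgg.tc f r W c θ ∂(RankAgg.prior ρ) with hX
    have htc : ∀ θ ∈ W, RankAgg.tc f r W c θ
        = ENNReal.ofReal (L / RankAgg.designValue f r W θ) := fun θ hθ =>
      RankAgg.tc_eq hc (hD₀pos.trans_le (hDle θ hθ))
    have hXle : X ≤ ENNReal.ofReal (L / D₀) := by
      calc X ≤ ∫⁻ _θ, ENNReal.ofReal (L / D₀) ∂(RankAgg.prior ρ) := by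
            refine lintegral_mono_ae ?_
            filter_upwards [hae] with θ hθ
            rw [htc θ hθ.1]
            exact ENNReal.ofReal_le_ofReal (div_le_div_of_nonneg_left hL.le hD₀pos (hDle θ hθ.1))
        _ = _ := by simp
    have hXpos : 0 < X := by
      calc 0 < ENNReal.ofReal (L / (2 * B)) := ENNReal.ofReal_pos.2 (by positivity)
        _ = ∫⁻ _θ, ENNReal.ofReal (L / (2 * B)) ∂(RankAgg.prior ρ) := by simp
        _ ≤ X := by
            refine lintegral_mono_ae ?_
            filter_upwards [hae] with θ hθ
            rw [htc θ hθ.1]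
            exact ENNReal.ofReal_le_ofReal (div_le_div_of_nonneg_left hL.le
              (hD₀pos.trans_le (hDle θ hθ.1)) (hDub θ hθ.1))
    have hcpos : 0 < ENNReal.ofReal c := ENNReal.ofReal_pos.2 hc.1
    refine (ENNReal.le_div_iff_mul_le (.inl (mul_ne_zero hcpos.ne' hXpos.ne'))
      (.inl (ENNReal.mul_ne_top ENNReal.ofReal_ne_top
        (ne_top_of_le_ne_top ENNReal.ofReal_ne_top hXle)))).2 (le_iInf fun π => ?_)
    rcases le_total (ENNReal.ofReal c * X) (RankAgg.bayesRisk f ρ c π) with hbig | hsmall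
    · refine le_trans (mul_le_of_le_one_left' ?_) hbig
      rw [ENNReal.ofReal_le_one]
      nlinarith
    -- a small Bayes risk makes early stopping without an inversion unlikely
    have hrisk : RankAgg.bayesRisk f ρ c π ≤ ENNReal.ofReal (c * (L / D₀)) := by
      rw [ENNReal.ofReal_mul hc.1.le]
      exact hsmall.trans (by gcongr)
    rw [RankAgg.Policy.bayesRisk_eq]
    calc ENNReal.ofReal ((1 - δ) ^ 2) * (ENNReal.ofReal c * X)
        = ∫⁻ θ, ENNReal.ofReal ((1 - δ) ^ 2) * ENNReal.ofReal c * RankAgg.tc f r W c θ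
            ∂(RankAgg.prior ρ) := by
          rw [lintegral_const_mul' _ _ (by finiteness), mul_assoc]
      _ ≤ ∫⁻ θ, π.risk f c θ ∂(RankAgg.prior ρ) := by
          refine lintegral_mono_ae ?_
          filter_upwards [hae] with θ hθ
          have hD := hD₀pos.trans_le (hDle θ hθ.1)
          set D := RankAgg.designValue f r W θ with hDdef
          set τ : ℝ := (1 - δ) * (L / D) with hτ
          have hLD : L / D ≤ L / D₀ :=
            div_le_div_of_nonneg_left hL.le hD₀pos (hDle θ hθ.1)
          have hτle : τ ≤ L / D₀ := by
            have : 0 < L / D := div_pos hL hD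
            nlinarith
          have hcτ : c * τ ≤ 1 := by
            have h1 : c * τ ≤ c * (L / D₀) := mul_le_mul_of_nonneg_left hτle hc.1.le
            have h2 : c * (L / D₀) ≤ 1 := by
              rw [← mul_div_assoc, div_le_one hD₀pos]
              linarith
            linarith
          have hearly := π.law_stopped_early_le (c := c) hr hae hpos hB hη
            (fun j hj => (hS j hj).1) hball hcover hnet hconst hθ.1 hθ.2 (hne θ) hδ hδ1 hL hD
            (hη1.trans (mul_le_mul_of_nonneg_left (hDle θ hθ.1) hδ.le)) hτ
          have hle := π.ofReal_mul_one_sub_le_risk f θ hc.1 hcτ (q := ENNReal.ofReal δ) <|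
            hearly.trans <| le_trans (Finset.sum_le_sum fun j hj => ?_)
              ((ENNReal.ofReal_sum_of_nonneg fun j hj => ?_).symm.le.trans
                (ENNReal.ofReal_le_ofReal hqc))
          · refine le_trans (le_of_eq ?_) hle
            rw [htc θ hθ.1, ← ENNReal.ofReal_one, ← ENNReal.ofReal_sub _ hδ.le,
              ← ENNReal.ofReal_mul (sq_nonneg _),
              ← ENNReal.ofReal_mul (mul_nonneg (sq_nonneg _) hc.1.le),
              ← ENNReal.ofReal_mul (mul_nonneg hc.1.le
                (mul_nonneg (by linarith) (div_pos hL hD).le))]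
            congr 1
            rw [← hDdef]
            ring
          · have hp := hball' j hj
            have hc0 := hc.1
            rw [ENNReal.ofReal_add (by positivity) (by positivity), ENNReal.ofReal_div_of_pos hp,
              ENNReal.ofReal_toReal (measure_ne_top _ _),
              ENNReal.ofReal_mul (Real.exp_pos _).le]
            gcongr
          · have hp := hball' j hj
            have hc0 := hc.1
            positivity
  refine le_of_tendsto (f := fun δ : ℝ => ENNReal.ofReal ((1 - δ) ^ 2)) (x := 𝓝[>] 0) ?_ ?_
  · have h : Tendsto (fun δ : ℝ => (1 - δ) ^ 2) (𝓝[>] 0) (𝓝 1) := by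
      have : Continuous fun δ : ℝ => (1 - δ) ^ 2 := by fun_prop
      simpa using (this.tendsto 0).mono_left nhdsWithin_le_nhds
    simpa using ENNReal.tendsto_ofReal h
  · filter_upwards [Ioo_mem_nhdsGT (zero_lt_one (α := ℝ))] with δ hδ using main δ hδ.1 hδ.2
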